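/- Let $K$ be a field equipped with a non-archimedean real (rank-1) valuation $w : K \to \mathbb{R}\cup\{\infty\}$, written additively, which is not discrete (its value group $w(K^\times)$ is not a discrete subgroup of $\mathbb{R}$), and assume that $K$ is complete with respect to $w$. Let $R=\{x\in K : w(x)\ge 0\}$ be the valuation ring of $w$ and let $\mathfrak m=\{x\in K : w(x)>0\}$ be its maximal ideal. For $f=\sum_{i\ge 0} f_iX^i\in R[[X]]$ put $w(f)=\inf_i w(f_i)$. Let $f\in R[[X]]$ be such that $w(f)=0$ and $f_i\in\mathfrak m$ for all $i\ge 0$. Then there are infinitely many pairwise distinct polynomials $p\in R[X]$ such that $p$ is monic, $p$ is irreducible in $R[X]$, the constant term of $p$ lies in $\mathfrak m$, and $p$ divides $f$ in $R[[X]]$. -/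

import Mathlib

open scoped Polynomial PowerSeries

namespace RealValuation

variable {K : Type*} [Field K]

/-- The valuation ring `{x | 0 ≤ w x}` of a real (additively written) valuation `w` on `K`. -/
noncomputable abbrev integerRing (w : AddValuation K (WithTop ℝ)) : ValuationSubring K :=
  (AddValuation.toValuation w).valuationSubring

theorem mem_integerRing_iff (w : AddValuation K (WithTop ℝ)) (x : K) : x ∈ integerRing w ↔ 0 ≤ w x :=
  Iff.rfl

/-- The value group `w(K^×)` is a cyclic subgroup of `ℝ`, that is, a discrete one;
this includes the trivial valuation. -/
def HasDiscreteValueGroup (w : AddValuation K (WithTop ℝ)) : Prop :=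
  ∃ c : ℝ, ∀ x : K, x ≠ 0 → ∃ n : ℤ, w x = ((n * c : ℝ) : WithTop ℝ)

/-- `u n` converges to `x` with respect to `w`, that is, `w (u n - x) → ∞`. -/
def ConvergesTo (w : AddValuation K (WithTop ℝ)) (u : ℕ → K) (x : K) : Prop :=
  ∀ C : ℝ, ∃ N : ℕ, ∀ n ≥ N, (C : WithTop ℝ) < w (u n - x)

/-- `u` is a Cauchy sequence with respect to `w`. -/
def IsCauchy (w : AddValuation K (WithTop ℝ)) (u : ℕ → K) : Prop :=
  ∀ C : ℝ, ∃ N : ℕ, ∀ m ≥ N, ∀ n ≥ N, (C : WithTop ℝ) < w (u m - u n)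

/-- `K` is complete with respect to `w`. -/
def IsComplete (w : AddValuation K (WithTop ℝ)) : Prop :=
  ∀ u : ℕ → K, IsCauchy w u → ∃ x : K, ConvergesTo w u x

/-- The Gauss valuation `w(f) = inf_i w(f_i)` of a power series over the valuation ring. -/
noncomputable def gauss (w : AddValuation K (WithTop ℝ)) (f : (integerRing w)⟦X⟧) : WithTop ℝ :=
  ⨅ i : ℕ, w ((PowerSeries.coeff i f : integerRing w) : K)

/-- The coefficients lie in the valuation ring, so the infimum is a genuine one. -/
theorem isGLB_gauss (w : AddValuation K (WithTop ℝ)) (f : (integerRing w)⟦X⟧) :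
    IsGLB (Set.range fun i : ℕ => w ((PowerSeries.coeff i f : integerRing w) : K)) (gauss w f) :=
  isGLB_ciInf ⟨0, by
    rintro _ ⟨i, rfl⟩
    exact (mem_integerRing_iff w _).1 (PowerSeries.coeff i f).2⟩

end RealValuation

/-!
The valuations of the coefficients of `f` are positive and have infimum `0`, so that the Newton
polygon of `f` has infinitely many slopes, tending to `0`, and each slope contributes a polynomial
factor.

For a real number `c > 0` let `k(c)` be the first index at which `w (fᵢ) + c * i` is minimal. Three facts
carry the proof.

* `exists_le_of_isFirstMin`: since the infimum `0` is not attained, `k(c)` is arbitrarily large for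
  suitable small values `c = w s`.
* `exists_dvd_of_isFirstMin`: if `c = w s`, then `f` has a monic divisor of degree `k(c)` whose lower
  coefficients lie in the maximal ideal. After the substitution `X ↦ s X` and division by
  a constant, `f` is congruent to `X ^ k(c)` times a unit modulo some principal ideal `(a)` with
  `w a > 0`; the valuation ring is `(a)`-adically complete, so Weierstrass preparation applies, and
  `scaleRoots_dvd_of_rescale_eq_mul` undoes the substitution without leaving the valuation ring.
* `IsFirstMin.natDegree_le_of_eq_mul`: a monic divisor of `f`, all of whose roots have valuation `> c`,
  has degree at most `k(c)`. The condition on the roots is expressed through the coefficients by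
  `IsDominated`; it is stable under products, and for a monic polynomial with lower coefficients in
  the maximal ideal it holds for all small `c`.

If only finitely many irreducible distinguished polynomials divided `f`, some `c` would dominate all of
them, hence all distinguished divisors of `f`, since these are products of such polynomials. Their degrees
would then be bounded by `k(c)`, whereas by the first two facts they are unbounded.
-/

namespace RealValuation

/-! ### Inequalities between real numbers and elements of `WithTop ℝ` -/

open Filter Topology

theorem coe_add_lt_add_of_lt_of_le {a b : ℝ} {x y : WithTop ℝ} (hx : (a : WithTop ℝ) < x)
    (hy : (b : WithTop ℝ) ≤ y) : ((a + b : ℝ) : WithTop ℝ) < x + y := by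
  induction x using WithTop.recTopCoe with
  | top => simp
  | coe x =>
    induction y using WithTop.recTopCoe with
    | top => simp
    | coe y =>
      norm_cast at *
      linarith

theorem coe_add_lt_add_of_le_of_lt {a b : ℝ} {x y : WithTop ℝ} (hx : (a : WithTop ℝ) ≤ x)
    (hy : (b : WithTop ℝ) < y) : ((a + b : ℝ) : WithTop ℝ) < x + y := by
  rw [add_comm a b, add_comm x y]
  exact coe_add_lt_add_of_lt_of_le hy hx

theorem exists_coe_eq_of_ne_top {x : WithTop ℝ} (hx : x ≠ ⊤) : ∃ r : ℝ, x = r :=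
  ⟨x.untop hx, (WithTop.coe_untop x hx).symm⟩

theorem eventually_coe_mul_lt {x : WithTop ℝ} (hx : 0 < x) (b : ℝ) :
    ∀ᶠ c in 𝓝[>] (0 : ℝ), ((c * b : ℝ) : WithTop ℝ) < x := by
  induction x using WithTop.recTopCoe with
  | top => exact Eventually.of_forall fun c => WithTop.coe_lt_top _
  | coe x =>
    norm_cast at hx
    have h : Tendsto (fun c : ℝ => c * b) (𝓝[>] 0) (𝓝 0) :=
      tendsto_nhdsWithin_of_tendsto_nhds (by simpa using (continuous_mul_const b).tendsto 0)
    filter_upwards [h.eventually_lt_const hx] with c hc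
    exact_mod_cast hc

/-! ### The first vertex of a power series of a given slope -/

section FirstMin

variable {A : Type*} [CommRing A] (v : AddValuation A (WithTop ℝ))

/-- `k` is the first index at which `v (fᵢ) + c * i` attains its minimum, and `V = v (fₖ)`: it is the
left end of the part of the Newton polygon of `f` that lies on a line of slope `-c`. The
inequalities are solved for `v (fᵢ)`, so that only real numbers are added or subtracted. -/
structure IsFirstMin (c : ℝ) (f : A⟦X⟧) (k : ℕ) (V : ℝ) : Prop where
  eq : v (PowerSeries.coeff k f) = V
  le : ∀ i : ℕ, ((V + c * (k - i) : ℝ) : WithTop ℝ) ≤ v (PowerSeries.coeff i f)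
  lt : ∀ i < k, ((V + c * (k - i) : ℝ) : WithTop ℝ) < v (PowerSeries.coeff i f)

/-- `p` is monic and its leading term alone attains the minimum of `v (pᵢ) + c * i`. When `p` splits,
this says that all its roots have valuation `> c`. -/
def IsDominated (c : ℝ) (p : A[X]) : Prop :=
  p.Monic ∧ ∀ i < p.natDegree, ((c * (p.natDegree - i) : ℝ) : WithTop ℝ) < v (p.coeff i)

variable {v}

/-- For `c > 0` and coefficients of nonnegative valuation, `v (fᵢ) + c * i` tends to infinity, so that
the minimum exists as soon as `f` has a coefficient of finite valuation. -/
theorem exists_isFirstMin {c : ℝ} (hc : 0 < c) {f : A⟦X⟧} (h0 : ∀ i, 0 ≤ v (PowerSeries.coeff i f))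
    {j : ℕ} (hj : v (PowerSeries.coeff j f) ≠ ⊤) : ∃ k V, IsFirstMin v c f k V := by
  classical
  let φ : ℕ → WithTop ℝ := fun i => v (PowerSeries.coeff i f) + ((c * i : ℝ) : WithTop ℝ)
  obtain ⟨r, hr⟩ := exists_coe_eq_of_ne_top hj
  obtain ⟨M, hM⟩ := exists_nat_gt ((r + c * j) / c)
  rw [div_lt_iff₀ hc] at hM
  -- The bound `M` is chosen so that `φ i > φ j` already follows from `c * i` for `i ≥ M`.
  have hex : ∃ k, ∀ i, φ k ≤ φ i := by
    obtain ⟨k, -, hk⟩ := Finset.exists_min_image (Finset.range (M + j + 1)) φ ⟨j, by simp⟩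
    refine ⟨k, fun i => ?_⟩
    by_cases hi : i < M + j + 1
    · exact hk i (Finset.mem_range.2 hi)
    · refine (hk j (by simp)).trans ?_
      calc φ j = ((r + c * j : ℝ) : WithTop ℝ) := by simp only [φ, hr]; norm_cast
        _ ≤ ((c * i : ℝ) : WithTop ℝ) := by
          have : (M : ℝ) ≤ i := by exact_mod_cast (by omega : M ≤ i)
          norm_cast
          nlinarith
        _ ≤ φ i := le_add_of_nonneg_left (h0 i)
  have hle := Nat.find_spec hex
  have hlt : ∀ i < Nat.find hex, φ (Nat.find hex) < φ i := fun i hi => by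
    by_contra! h
    exact Nat.find_min hex hi fun l => h.trans (hle l)
  generalize Nat.find hex = k at hle hlt
  have hk : v (PowerSeries.coeff k f) ≠ ⊤ := fun h => by
    have := hle j
    simp only [φ, hr, h, top_add, top_le_iff] at this
    norm_cast at this
  obtain ⟨V, hV⟩ := exists_coe_eq_of_ne_top hk
  refine ⟨k, V, hV, fun i => ?_, fun i hi => ?_⟩
  · have := hle i
    simp only [φ, hV] at this
    generalize v (PowerSeries.coeff i f) = y at *
    induction y using WithTop.recTopCoe with
    | top => simp
    | coe y =>
      rw [← WithTop.coe_add, ← WithTop.coe_add, WithTop.coe_le_coe] at this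
      rw [WithTop.coe_le_coe]
      linarith
  · have := hlt i hi
    simp only [φ, hV] at this
    generalize v (PowerSeries.coeff i f) = y at *
    induction y using WithTop.recTopCoe with
    | top => exact WithTop.coe_lt_top _
    | coe y =>
      rw [← WithTop.coe_add, ← WithTop.coe_add, WithTop.coe_lt_coe] at this
      rw [WithTop.coe_lt_coe]
      linarith

theorem IsDominated.le {c : ℝ} {p : A[X]} (hp : IsDominated v c p) (i : ℕ) :
    ((c * (p.natDegree - i) : ℝ) : WithTop ℝ) ≤ v (p.coeff i) := by
  rcases lt_trichotomy i p.natDegree with h | rfl | h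
  · exact (hp.2 i h).le
  · simp [hp.1.coeff_natDegree]
  · simp [Polynomial.coeff_eq_zero_of_natDegree_lt h]

theorem IsDominated.mul {c : ℝ} {p q : A[X]} (hp : IsDominated v c p) (hq : IsDominated v c q) :
    IsDominated v c (p * q) := by
  refine ⟨hp.1.mul hq.1, fun l hl => ?_⟩
  rw [hp.1.natDegree_mul hq.1] at hl ⊢
  rw [Polynomial.coeff_mul]
  refine v.map_lt_sum WithTop.coe_ne_top fun ij hij => ?_
  obtain ⟨i, j⟩ := ij
  obtain rfl : i + j = l := by simpa using hij
  have : (c * ((p.natDegree + q.natDegree : ℕ) - (i + j : ℕ)) : ℝ)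
      = c * (p.natDegree - i) + c * (q.natDegree - j) := by push_cast; ring
  rw [v.map_mul, this]
  rcases lt_or_ge i p.natDegree with hi | hi
  · exact coe_add_lt_add_of_lt_of_le (hp.2 i hi) (hq.le j)
  · exact coe_add_lt_add_of_le_of_lt (hp.le i) (hq.2 j (by omega))

/-- The degree of a dominated divisor of `f` is at most the first minimizing index `k` of `f`. Indeed,
if `l` is the first minimizing index of the cofactor `q`, then among the products `pᵢ qⱼ` the minimum
is attained first, and at index `p.natDegree + l` only once, by the leading coefficient of `p`
times `q_l`. -/
theorem IsFirstMin.natDegree_le_of_eq_mul {c : ℝ} {f q : A⟦X⟧} {p : A[X]} {k l : ℕ} {V V' : ℝ}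
    (hf : IsFirstMin v c f k V) (hp : IsDominated v c p) (hq : IsFirstMin v c q l V')
    (h : f = p * q) : p.natDegree ≤ k := by
  by_contra! hk
  have key : ∀ i j : ℕ, i + j ≤ p.natDegree + l → (i, j) ≠ (p.natDegree, l) →
      ((V' + c * (p.natDegree + l - (i + j : ℕ)) : ℝ) : WithTop ℝ)
        < v (PowerSeries.coeff i (p : A⟦X⟧) * PowerSeries.coeff j q) := by
    intro i j hij hne
    have : (V' + c * (p.natDegree + l - (i + j : ℕ)) : ℝ)
        = c * (p.natDegree - i) + (V' + c * (l - j)) := by push_cast; ring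
    rw [v.map_mul, this, Polynomial.coeff_coe]
    rcases lt_trichotomy i p.natDegree with hi | rfl | hi
    · exact coe_add_lt_add_of_lt_of_le (hp.2 i hi) (hq.le j)
    · refine coe_add_lt_add_of_le_of_lt (hp.le _) (hq.lt j ?_)
      have : j ≠ l := fun hj => hne (by rw [hj])
      omega
    · rw [Polynomial.coeff_eq_zero_of_natDegree_lt hi, v.map_zero, top_add]
      exact WithTop.coe_lt_top _
  have htop : v (PowerSeries.coeff (p.natDegree + l) f) = V' := by
    rw [h, PowerSeries.coeff_mul, ← Finset.add_sum_erase _ _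
      (Finset.HasAntidiagonal.mem_antidiagonal.2
        (rfl : (p.natDegree, l).1 + (p.natDegree, l).2 = p.natDegree + l))]
    have hval : v (PowerSeries.coeff p.natDegree (p : A⟦X⟧) * PowerSeries.coeff l q) = V' := by
      rw [Polynomial.coeff_coe, hp.1.coeff_natDegree, one_mul, hq.eq]
    refine (v.map_add_eq_of_lt_left ?_).trans hval
    simp only [hval]
    refine v.map_lt_sum WithTop.coe_ne_top fun ij hij => ?_
    obtain ⟨hne, hmem⟩ := Finset.mem_erase.1 hij
    have hs : ij.1 + ij.2 = p.natDegree + l := by simpa using hmem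
    have := key ij.1 ij.2 hs.le hne
    rw [hs] at this
    simpa using this
  have hlow : ((V' + c * (p.natDegree + l - k) : ℝ) : WithTop ℝ) < v (PowerSeries.coeff k f) := by
    rw [h, PowerSeries.coeff_mul]
    refine v.map_lt_sum WithTop.coe_ne_top fun ij hij => ?_
    have hs : ij.1 + ij.2 = k := by simpa using hij
    have := key ij.1 ij.2 (by omega) (fun he => by
      obtain ⟨i, j⟩ := ij
      simp only [Prod.mk.injEq] at he
      simp only at hs
      omega)
    rwa [hs] at this
  have hmin := hf.le (p.natDegree + l)
  rw [htop] at hmin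
  rw [hf.eq] at hlow
  rw [WithTop.coe_le_coe] at hmin
  rw [WithTop.coe_lt_coe] at hlow
  push_cast at hmin
  linarith

/-- A monic polynomial whose lower coefficients have positive valuation is dominated for all
small `c > 0`. -/
theorem eventually_isDominated {p : A[X]} (hp : p.Monic)
    (h : ∀ i < p.natDegree, 0 < v (p.coeff i)) : ∀ᶠ c in 𝓝[>] (0 : ℝ), IsDominated v c p := by
  have : ∀ᶠ c in 𝓝[>] (0 : ℝ), ∀ i ∈ Set.Iio p.natDegree,
      ((c * (p.natDegree - i) : ℝ) : WithTop ℝ) < v (p.coeff i) :=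
    (eventually_all_finite (Set.finite_Iio _)).2 fun i hi => eventually_coe_mul_lt (h i hi) _
  exact this.mono fun c hc => ⟨hp, hc⟩

/-- If the valuations of the coefficients of `f` are positive and have infimum `0`, then the first
minimizing index is arbitrarily large for suitable small `c`, which may be chosen among the
valuations of the coefficients. -/
theorem exists_le_of_isFirstMin {f : A⟦X⟧} (h : ∀ i, 0 < v (PowerSeries.coeff i f))
    (hinf : ∀ ε : ℝ, 0 < ε → ∃ i, v (PowerSeries.coeff i f) < ε) (N : ℕ) :
    ∃ (a : A) (c : ℝ), 0 < c ∧ v a = c ∧ ∀ k V, IsFirstMin v c f k V → N ≤ k := by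
  -- `ε` lies below the valuations of the first `N` coefficients, `v (f_j) < ε / 2`, and `c` is so
  -- small that `c * j < ε / 2`: then no index below `N` is minimizing.
  have hev : ∀ᶠ ε in 𝓝[>] (0 : ℝ), ∀ i ∈ Set.Iio N,
      ((ε * 1 : ℝ) : WithTop ℝ) < v (PowerSeries.coeff i f) :=
    (eventually_all_finite (Set.finite_Iio _)).2 fun i _ => eventually_coe_mul_lt (h i) _
  obtain ⟨ε, hε, hε0⟩ := (hev.and self_mem_nhdsWithin).exists
  simp only [mul_one, Set.mem_Iio] at hε
  obtain ⟨j, hj⟩ := hinf (ε / 2) (by linarith)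
  obtain ⟨r, hr⟩ := exists_coe_eq_of_ne_top (ne_top_of_lt hj)
  obtain ⟨i, hi⟩ := hinf (ε / (2 * (j + 1))) (by positivity)
  obtain ⟨c, hc⟩ := exists_coe_eq_of_ne_top (ne_top_of_lt hi)
  have hc0 := h i
  rw [hc] at hi hc0
  rw [hr, WithTop.coe_lt_coe] at hj
  rw [WithTop.coe_lt_coe] at hi
  norm_cast at hc0
  refine ⟨_, c, hc0, hc, fun k V hk => ?_⟩
  by_contra! hkN
  have h1 := hε k hkN
  have h2 := hk.le j
  rw [hk.eq, WithTop.coe_lt_coe] at h1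
  rw [hr, WithTop.coe_le_coe] at h2
  rw [lt_div_iff₀ (by positivity)] at hi
  have : 0 ≤ c * k := by positivity
  nlinarith

end FirstMin
/-! ### The valuation ring -/

section Ring

variable {K : Type*} [Field K] {w : AddValuation K (WithTop ℝ)}

variable (w) in
/-- The restriction of `w` to its valuation ring. -/
noncomputable def val : AddValuation (integerRing w) (WithTop ℝ) :=
  w.comap (integerRing w).subtype

theorem val_apply (x : integerRing w) : val w x = w (x : K) := rfl

theorem val_nonneg (x : integerRing w) : 0 ≤ val w x :=
  (mem_integerRing_iff w _).1 x.2

theorem val_eq_top_iff {x : integerRing w} : val w x = ⊤ ↔ x = 0 := by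
  rw [val_apply, AddValuation.top_iff, ZeroMemClass.coe_eq_zero]

theorem dvd_iff_val_le {x y : integerRing w} : x ∣ y ↔ val w x ≤ val w y := by
  constructor
  · rintro ⟨z, rfl⟩
    rw [AddValuation.map_mul]
    exact le_add_of_nonneg_right (val_nonneg z)
  · intro h
    rcases eq_or_ne x 0 with rfl | hx
    · rw [AddValuation.map_zero, top_le_iff, val_eq_top_iff] at h
      rw [h]
    have hxK : (x : K) ≠ 0 := by exact_mod_cast hx
    obtain ⟨r, hr⟩ := exists_coe_eq_of_ne_top (mt val_eq_top_iff.1 hx)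
    have hmul : (x : K) * ((y : K) / x) = y := mul_div_cancel₀ _ hxK
    have hz : (y : K) / x ∈ integerRing w := by
      rw [mem_integerRing_iff]
      rw [val_apply] at hr
      rw [val_apply, val_apply, ← hmul, AddValuation.map_mul, hr] at h
      generalize w ((y : K) / x) = t at *
      induction t using WithTop.recTopCoe with
      | top => simp
      | coe t =>
        norm_cast at *
        linarith
    exact ⟨⟨_, hz⟩, Subtype.ext hmul.symm⟩

theorem mem_maximalIdeal_iff {x : integerRing w} :
    x ∈ IsLocalRing.maximalIdeal (integerRing w) ↔ 0 < val w x := by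
  rw [IsLocalRing.mem_maximalIdeal, mem_nonunits_iff, isUnit_iff_dvd_one, dvd_iff_val_le,
    AddValuation.map_one, not_le]

theorem val_pow {a : integerRing w} {c : ℝ} (ha : val w a = c) (n : ℕ) :
    val w (a ^ n) = ((n * c : ℝ) : WithTop ℝ) := by
  rw [AddValuation.map_pow, ha, ← WithTop.coe_nsmul, nsmul_eq_mul]

/-- The valuation ring is complete for every ideal generated by an element `a` of positive finite
valuation. The maximal ideal itself will not do: it may be idempotent, and then its adic topology
is not that of `w`. -/
theorem isAdicComplete_span_singleton (hcomp : IsComplete w) {a : integerRing w} {c : ℝ}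
    (hc : 0 < c) (ha : val w a = c) :
    IsAdicComplete (Ideal.span {a}) (integerRing w) := by
  have hmod : ∀ (n : ℕ) (x y : integerRing w),
      x ≡ y [SMOD ((Ideal.span {a}) ^ n • ⊤ : Submodule (integerRing w) (integerRing w))] ↔
        ((n * c : ℝ) : WithTop ℝ) ≤ val w (x - y) := fun n x y => by
    rw [SModEq.sub_mem, smul_eq_mul, Ideal.mul_top, Ideal.span_singleton_pow,
      Ideal.mem_span_singleton, dvd_iff_val_le, val_pow ha]
  have harch : ∀ C : ℝ, ∃ n : ℕ, C < n * c := fun C => by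
    obtain ⟨n, hn⟩ := exists_nat_gt (C / c)
    exact ⟨n, (div_lt_iff₀ hc).1 hn⟩
  refine { haus' := fun x hx => ?_, prec' := fun f hf => ?_ }
  · by_contra hx0
    obtain ⟨r, hr⟩ := exists_coe_eq_of_ne_top (mt val_eq_top_iff.1 hx0)
    obtain ⟨n, hn⟩ := harch r
    have := (hmod n x 0).1 (hx n)
    rw [sub_zero, hr, WithTop.coe_le_coe] at this
    linarith
  · have hf' : ∀ {m n : ℕ}, m ≤ n → ((m * c : ℝ) : WithTop ℝ) ≤ val w (f m - f n) :=
      fun h => (hmod _ _ _).1 (hf h)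
    have hcauchy : IsCauchy w fun n => (f n : K) := fun C => by
      obtain ⟨N, hN⟩ := harch C
      refine ⟨N, fun m hm n hn => (WithTop.coe_lt_coe.2 hN).trans_le ?_⟩
      have h1 := hf' hm
      have h2 := hf' hn
      rw [AddValuation.map_sub_swap] at h1
      have h3 := (val w).map_le_add h1 h2
      rw [sub_add_sub_cancel, val_apply] at h3
      exact_mod_cast h3
    obtain ⟨x, hx⟩ := hcomp _ hcauchy
    have hlim : ∀ n : ℕ, ((n * c : ℝ) : WithTop ℝ) ≤ w ((f n : K) - x) := fun n => by
      obtain ⟨N, hN⟩ := hx (n * c)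
      have h1 := hf' (le_max_left n N)
      have h2 := (hN _ (le_max_right n N)).le
      rw [val_apply] at h1
      have h3 := w.map_le_add h1 h2
      simpa using h3
    have hxR : x ∈ integerRing w := by
      rw [mem_integerRing_iff]
      have h1 := hlim 0
      have h2 := w.map_le_sub (val_nonneg (f 0)) (by simpa using h1)
      simpa using h2
    exact ⟨⟨x, hxR⟩, fun n => (hmod _ _ _).2 (hlim n)⟩

end Ring

/-! ### Distinguished polynomials and Weierstrass preparation -/

section Distinguished

variable {A : Type*} [CommRing A]

theorem isDistinguishedAt_of_dvd {I : Ideal A} [I.IsPrime] {p Q : A[X]} (hp : p.Monic)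
    (hQ : Q.IsDistinguishedAt I) (h : p ∣ Q) : p.IsDistinguishedAt I := by
  have hdvd : p.map (Ideal.Quotient.mk I) ∣ Polynomial.X ^ Q.natDegree := by
    rw [← hQ.map_eq_X_pow]
    exact Polynomial.map_dvd _ h
  obtain ⟨i, -, hi⟩ := (dvd_prime_pow Polynomial.prime_X _).1 hdvd
  have heq := Polynomial.eq_of_monic_of_associated (hp.map _) (Polynomial.monic_X_pow i) hi
  have hdeg : p.natDegree = i := by
    rw [← hp.natDegree_map (Ideal.Quotient.mk I), heq, Polynomial.natDegree_X_pow]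
  refine ⟨⟨fun {n} hn => ?_⟩, hp⟩
  rw [← Ideal.Quotient.eq_zero_iff_mem, ← Polynomial.coeff_map, heq, Polynomial.coeff_X_pow,
    if_neg (by omega)]

/-- Domination passes from the irreducible monic factors of a distinguished polynomial to the
polynomial itself, because it is stable under products. -/
theorem isDominated_of_irreducible_factors [IsDomain A] {I : Ideal A} [I.IsPrime]
    {v : AddValuation A (WithTop ℝ)} {c : ℝ} (Q : A[X]) (hQ : Q.IsDistinguishedAt I)
    (h : ∀ p : A[X], p.IsDistinguishedAt I → Irreducible p → p ∣ Q → IsDominated v c p) :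
    IsDominated v c Q := by
  induction hn : Q.natDegree using Nat.strong_induction_on generalizing Q with
  | _ n ih =>
    subst hn
    by_cases h1 : Q = 1
    · subst h1
      exact ⟨Polynomial.monic_one, by simp⟩
    by_cases hirr : Irreducible Q
    · exact h Q hQ hirr dvd_rfl
    rw [Polynomial.irreducible_of_monic hQ.monic h1] at hirr
    push Not at hirr
    obtain ⟨a, b, ha, hb, rfl, ha1, hb1⟩ := hirr
    have hdeg := ha.natDegree_mul hb
    have ha0 := mt ha.natDegree_eq_zero.1 ha1
    have hb0 := mt hb.natDegree_eq_zero.1 hb1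
    refine IsDominated.mul ?_ ?_
    · exact ih a.natDegree (by omega) a (isDistinguishedAt_of_dvd ha hQ (dvd_mul_right a b))
        (fun p hp hpi hpd => h p hp hpi (hpd.mul_right b)) rfl
    · exact ih b.natDegree (by omega) b (isDistinguishedAt_of_dvd hb hQ (dvd_mul_left b a))
        (fun p hp hpi hpd => h p hp hpi (hpd.mul_left a)) rfl

/-- Weierstrass preparation at an ideal `I` that need not be maximal, for a power series which is
congruent to `X ^ k` times a unit modulo `I`, normalized so that its `k`-th coefficient is `1`.
The distinguished polynomial is `X ^ k - r`, with `r` the remainder of `X ^ k` on Weierstrass division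
by `g`. -/
theorem exists_isDistinguishedAt_eq_mul_unit [IsLocalRing A] {I : Ideal A} [IsAdicComplete I A]
    (hI : I ≤ IsLocalRing.maximalIdeal A) {g : A⟦X⟧} {k : ℕ} (hk : PowerSeries.coeff k g = 1)
    (hlt : ∀ i < k, PowerSeries.coeff i g ∈ I) :
    ∃ (P : A[X]) (u : A⟦X⟧), P.natDegree = k ∧ g.IsWeierstrassFactorizationAt P u I := by
  have hItop : I ≠ ⊤ := fun h => (IsLocalRing.maximalIdeal.isMaximal A).ne_top (top_le_iff.1 (h ▸ hI))
  have hord : (g.map (Ideal.Quotient.mk I)).order.toNat = k := by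
    have : (g.map (Ideal.Quotient.mk I)).order = k := by
      rw [PowerSeries.order_eq_nat]
      refine ⟨?_, fun i hi => ?_⟩
      · rw [PowerSeries.coeff_map, hk, ne_eq, Ideal.Quotient.eq_zero_iff_mem,
          ← Ideal.ne_top_iff_one]
        exact hItop
      · rw [PowerSeries.coeff_map, Ideal.Quotient.eq_zero_iff_mem]
        exact hlt i hi
    simp [this]
  have hdiv : g.IsWeierstrassDivisorAt I := by
    rw [PowerSeries.IsWeierstrassDivisorAt, hord, hk]
    exact isUnit_one
  have H := hdiv.isWeierstrassDivisionAt_div_mod (PowerSeries.X ^ k)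
  generalize hdiv.div (PowerSeries.X ^ k) = q at H
  generalize hdiv.mod (PowerSeries.X ^ k) = r at H
  have hdeg := H.degree_lt
  have hmem : ∀ i < k, r.coeff i ∈ I := fun i hi => by
    have := H.coeff_f_sub_r_mem (i := i) (by rwa [hord])
    rw [map_sub, PowerSeries.coeff_X_pow, if_neg hi.ne, zero_sub, neg_mem_iff,
      Polynomial.coeff_coe] at this
    exact this
  rw [hord] at hdeg
  have hPmonic : (Polynomial.X ^ k - r).Monic := Polynomial.monic_X_pow_sub hdeg
  have hPdeg : (Polynomial.X ^ k - r).natDegree = k := by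
    have := Polynomial.degree_sub_eq_left_of_degree_lt
      (p := (Polynomial.X ^ k : A[X])) (q := r) (by rwa [Polynomial.degree_X_pow])
    rw [Polynomial.degree_X_pow] at this
    exact Polynomial.natDegree_eq_of_degree_eq_some this
  have hP : ((Polynomial.X ^ k - r : A[X]) : A⟦X⟧) = g * q := by
    rw [Polynomial.coe_sub, Polynomial.coe_pow, Polynomial.coe_X, H.eq_mul_add]
    ring
  -- Modulo the maximal ideal, the `k`-th coefficient of `g * q` is the constant coefficient of `q`.
  have hq : IsUnit q := by
    rw [PowerSeries.isUnit_iff_constantCoeff]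
    by_contra hq0
    have h1 : PowerSeries.coeff k (g * q) = 1 := by
      rw [← hP, Polynomial.coeff_coe]
      simpa [hPdeg] using hPmonic.coeff_natDegree
    refine (Ideal.ne_top_iff_one _).1 (IsLocalRing.maximalIdeal.isMaximal A).ne_top ?_
    rw [← h1, PowerSeries.coeff_mul]
    refine Ideal.sum_mem _ fun ij hij => ?_
    have hs : ij.1 + ij.2 = k := by simpa using hij
    rcases Nat.eq_zero_or_pos ij.2 with h0 | h0
    · refine Ideal.mul_mem_left _ _ ?_
      rw [h0, PowerSeries.coeff_zero_eq_constantCoeff_apply]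
      exact hq0
    · exact Ideal.mul_mem_right _ _ (hI (hlt _ (by omega)))
  obtain ⟨u, rfl⟩ := hq
  refine ⟨_, ↑u⁻¹, hPdeg, ⟨⟨fun {n} hn => ?_⟩, hPmonic⟩, Units.isUnit _, ?_⟩
  · rw [hPdeg] at hn
    rw [Polynomial.coeff_sub, Polynomial.coeff_X_pow, if_neg hn.ne, zero_sub, neg_mem_iff]
    exact hmem n hn
  · rw [hP, mul_assoc, Units.mul_inv, mul_one]

end Distinguished
/-! ### Factors attached to the slopes -/

section Factor

theorem rescale_scaleRoots {A : Type*} [CommRing A] (P : A[X]) (s : A) :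
    PowerSeries.rescale s (P.scaleRoots s : A⟦X⟧)
      = PowerSeries.C (s ^ P.natDegree) * (P : A⟦X⟧) := by
  ext i
  rw [PowerSeries.coeff_rescale, PowerSeries.coeff_C_mul, Polynomial.coeff_coe,
    Polynomial.coeff_coe, Polynomial.coeff_scaleRoots]
  rcases le_or_gt i P.natDegree with h | h
  · rw [mul_left_comm, ← pow_add, Nat.add_sub_cancel' h, mul_comm]
  · simp [Polynomial.coeff_eq_zero_of_natDegree_lt h]

/-- If a distinguished polynomial `P` divides `f (s X)`, then the polynomial `P.scaleRoots s`, that is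
`s ^ n * P (X / s)`, divides `f`. The point is that the quotient has coefficients in `A` itself: the
remainder of `f` on Weierstrass division by `P.scaleRoots s` becomes, on substituting `s X`, a
remainder on division of a multiple of `P` by `P`, so it vanishes. -/
theorem scaleRoots_dvd_of_rescale_eq_mul {A : Type*} [CommRing A] [IsDomain A] {I : Ideal A}
    [IsAdicComplete I A] {P : A[X]} (hP : P.IsDistinguishedAt I) {s : A} (hs : s ≠ 0)
    {f h : A⟦X⟧} (hf : PowerSeries.rescale s f = P * h) : (P.scaleRoots s : A⟦X⟧) ∣ f := by
  have hI : I ≠ ⊤ := by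
    rintro rfl
    exact not_subsingleton A (IsHausdorff.subsingleton (R := A) (M := A) inferInstance)
  have horder : ∀ {R : A[X]}, R.IsDistinguishedAt I →
      ((R : A⟦X⟧).map (Ideal.Quotient.mk I)).order.toNat = R.natDegree := fun {R} hR =>
    congr(ENat.toNat $(hR.coe_natDegree_eq_order_map R 1
      (by rwa [PowerSeries.constantCoeff_one, ← Ideal.ne_top_iff_one]) (by simp))).symm
  have hQ : (P.scaleRoots s).IsDistinguishedAt I := by
    refine ⟨⟨fun {n} hn => ?_⟩, (Polynomial.monic_scaleRoots_iff s).2 hP.monic⟩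
    rw [Polynomial.natDegree_scaleRoots] at hn
    rw [Polynomial.coeff_scaleRoots]
    exact Ideal.mul_mem_right _ _ (hP.mem hn)
  have H := (hQ.isWeierstrassDivisorAt hI).isWeierstrassDivisionAt_div_mod f
  generalize (hQ.isWeierstrassDivisorAt hI).div f = q at H
  generalize (hQ.isWeierstrassDivisorAt hI).mod f = r at H
  have hdeg := H.degree_lt
  rw [horder hQ, Polynomial.natDegree_scaleRoots] at hdeg
  have hr : ((r.comp (Polynomial.C s * Polynomial.X) : A[X]) : A⟦X⟧)
      = PowerSeries.rescale s (r : A⟦X⟧) := by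
    ext i
    rw [Polynomial.coeff_coe, Polynomial.comp_C_mul_X_coeff, PowerSeries.coeff_rescale,
      Polynomial.coeff_coe, mul_comm]
  have hdeg' : (r.comp (Polynomial.C s * Polynomial.X)).degree < P.natDegree := by
    rw [Polynomial.degree_lt_iff_coeff_zero] at hdeg ⊢
    intro m hm
    rw [Polynomial.comp_C_mul_X_coeff, hdeg m hm, zero_mul]
  have heq : (P : A⟦X⟧) * (h - PowerSeries.C (s ^ P.natDegree) * PowerSeries.rescale s q)
      = ((r.comp (Polynomial.C s * Polynomial.X) : A[X]) : A⟦X⟧) := by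
    rw [hr, mul_sub, ← hf, H.eq_mul_add, map_add, map_mul, rescale_scaleRoots]
    ring
  have hzero := ((hP.isWeierstrassDivisorAt hI).eq_zero_of_mul_eq
    (by rwa [horder hP]) heq).2
  have hr0 : r = 0 := by
    ext i
    have := congrArg (fun t => Polynomial.coeff t i) hzero
    simpa [Polynomial.comp_C_mul_X_coeff, hs] using this
  exact ⟨q, by rw [H.eq_mul_add, hr0]; simp⟩

variable {K : Type*} [Field K] {w : AddValuation K (WithTop ℝ)}

/-- If `k` is the first minimizing index of `f` for `c = w s`, then `f` has a distinguished divisor of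
degree `k`. It comes from Weierstrass preparation for `g = f (s X) / (s ^ k * fₖ)`, whose `k`-th
coefficient is `1` and whose lower coefficients lie in the maximal ideal. -/
theorem exists_dvd_of_isFirstMin (hcomp : IsComplete w) {c : ℝ} (hc : 0 < c)
    {s : integerRing w} (hs : val w s = c) {f : (integerRing w)⟦X⟧} {k : ℕ} {V : ℝ}
    (hf : IsFirstMin (val w) c f k V) :
    ∃ Q : (integerRing w)[X], Q.IsDistinguishedAt (IsLocalRing.maximalIdeal (integerRing w)) ∧
      Q.natDegree = k ∧ (Q : (integerRing w)⟦X⟧) ∣ f := by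
  have hs0 : s ≠ 0 := fun h => by
    rw [val_eq_top_iff.2 h] at hs
    exact WithTop.coe_ne_top hs.symm
  have hd : val w (s ^ k * PowerSeries.coeff k f) = ((V + c * k : ℝ) : WithTop ℝ) := by
    rw [AddValuation.map_mul, val_pow hs, hf.eq, ← WithTop.coe_add]
    congr 1
    ring
  have hd0 : s ^ k * PowerSeries.coeff k f ≠ 0 := fun h => by
    rw [val_eq_top_iff.2 h] at hd
    exact WithTop.coe_ne_top hd.symm
  have hdvd : ∀ i, s ^ k * PowerSeries.coeff k f ∣ s ^ i * PowerSeries.coeff i f := fun i => by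
    rw [dvd_iff_val_le, hd, AddValuation.map_mul, val_pow hs]
    have : (V + c * k : ℝ) = i * c + (V + c * (k - i)) := by ring
    rw [this, WithTop.coe_add]
    exact add_le_add_right (hf.le i) _
  choose γ hγ using hdvd
  have hγk : γ k = 1 := by
    have := hγ k
    rwa [eq_comm, mul_eq_left₀ hd0] at this
  have hγlt : ∀ i < k, 0 < val w (γ i) := fun i hi => by
    by_contra! h
    have h0 : val w (γ i) = 0 := le_antisymm h (val_nonneg _)
    have h1 := congrArg (val w) (hγ i)
    rw [AddValuation.map_mul, AddValuation.map_mul, hd, h0, add_zero, val_pow hs] at h1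
    have h2 := coe_add_lt_add_of_le_of_lt (le_refl ((i * c : ℝ) : WithTop ℝ)) (hf.lt i hi)
    rw [h1, WithTop.coe_lt_coe] at h2
    linarith
  -- An ideal containing the lower coefficients of `g` for which the ring is complete; `s` is put
  -- among the candidates for a generator to make sure that the generator is not zero.
  obtain ⟨a, ha0, hatop, ha⟩ : ∃ a : integerRing w, 0 < val w a ∧ val w a ≠ ⊤ ∧
      ∀ i < k, a ∣ γ i := by
    classical
    obtain ⟨a, ha, hmin⟩ := Finset.exists_min_image
      (insert s ((Finset.range k).image γ)) (val w) ⟨s, Finset.mem_insert_self _ _⟩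
    refine ⟨a, ?_, ?_, fun i hi => ?_⟩
    · rcases Finset.mem_insert.1 ha with rfl | ha
      · rw [hs]
        exact_mod_cast hc
      · obtain ⟨i, hi, rfl⟩ := Finset.mem_image.1 ha
        exact hγlt i (Finset.mem_range.1 hi)
    · have := hmin s (Finset.mem_insert_self _ _)
      rw [hs] at this
      exact ne_top_of_le_ne_top WithTop.coe_ne_top this
    · rw [dvd_iff_val_le]
      exact hmin _ (Finset.mem_insert_of_mem
        (Finset.mem_image_of_mem γ (Finset.mem_range.2 hi)))
  obtain ⟨α, hα⟩ := exists_coe_eq_of_ne_top hatop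
  have := isAdicComplete_span_singleton hcomp (by rw [hα] at ha0; exact_mod_cast ha0) hα
  have hle : Ideal.span {a} ≤ IsLocalRing.maximalIdeal (integerRing w) := by
    rw [Ideal.span_singleton_le_iff_mem, mem_maximalIdeal_iff]
    exact ha0
  obtain ⟨P, u, hdeg, hfac⟩ := exists_isDistinguishedAt_eq_mul_unit hle
    (g := PowerSeries.mk γ) (k := k) (by rw [PowerSeries.coeff_mk, hγk]) (fun i hi => by
      rw [PowerSeries.coeff_mk, Ideal.mem_span_singleton]
      exact ha i hi)
  have hresc : PowerSeries.rescale s f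
      = P * (PowerSeries.C (s ^ k * PowerSeries.coeff k f) * u) := by
    rw [mul_left_comm, ← hfac.eq_mul]
    ext i
    rw [PowerSeries.coeff_rescale, PowerSeries.coeff_C_mul, PowerSeries.coeff_mk, hγ]
  refine ⟨P.scaleRoots s, ⟨⟨fun {n} hn => ?_⟩,
    (Polynomial.monic_scaleRoots_iff s).2 hfac.isDistinguishedAt.monic⟩,
    by rw [Polynomial.natDegree_scaleRoots, hdeg],
    scaleRoots_dvd_of_rescale_eq_mul hfac.isDistinguishedAt hs0 hresc⟩
  rw [Polynomial.natDegree_scaleRoots] at hn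
  rw [Polynomial.coeff_scaleRoots]
  exact Ideal.mul_mem_right _ _ (hle (hfac.isDistinguishedAt.mem hn))

theorem exists_val_coeff_lt_of_gauss_eq_zero {f : (integerRing w)⟦X⟧} (hf : gauss w f = 0) {ε : ℝ}
    (hε : 0 < ε) : ∃ i, val w (PowerSeries.coeff i f) < ε := by
  by_contra! h
  have := (isGLB_gauss w f).2 (by rintro _ ⟨i, rfl⟩; exact h i)
  rw [hf] at this
  norm_cast at this
  linarith

end Factor
end RealValuation

open RealValuation Filter Topology in
theorem proposition2p5 {K : Type*} [Field K] (w : AddValuation K (WithTop ℝ))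
    (hdisc : ¬ RealValuation.HasDiscreteValueGroup w)
    (hcomp : RealValuation.IsComplete w)
    (f : (RealValuation.integerRing w)⟦X⟧)
    (hf : RealValuation.gauss w f = 0)
    (hm : ∀ i : ℕ, PowerSeries.coeff i f ∈ IsLocalRing.maximalIdeal (RealValuation.integerRing w)) :
    {p : (RealValuation.integerRing w)[X] | p.Monic ∧ Irreducible p ∧
      p.coeff 0 ∈ IsLocalRing.maximalIdeal (RealValuation.integerRing w) ∧
      (p : (RealValuation.integerRing w)⟦X⟧) ∣ f}.Infinite := by
  have hpos : ∀ i, 0 < val w (PowerSeries.coeff i f) := fun i => mem_maximalIdeal_iff.1 (hm i)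
  have hinf : ∀ ε : ℝ, 0 < ε → ∃ i, val w (PowerSeries.coeff i f) < ε := fun ε hε =>
    exists_val_coeff_lt_of_gauss_eq_zero hf hε
  obtain ⟨i₀, hi₀⟩ := hinf 1 one_pos
  have hi₀top := ne_top_of_lt hi₀
  -- By strengthening the condition on the constant term, every `p` below is dominated for small `c`.
  have hsub : {p : (integerRing w)[X] |
      p.IsDistinguishedAt (IsLocalRing.maximalIdeal (integerRing w)) ∧ Irreducible p ∧
      (p : (integerRing w)⟦X⟧) ∣ f} ⊆ {p | p.Monic ∧ Irreducible p ∧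
      p.coeff 0 ∈ IsLocalRing.maximalIdeal (integerRing w) ∧ (p : (integerRing w)⟦X⟧) ∣ f} :=
    fun p ⟨hp, hirr, hpf⟩ => ⟨hp.monic, hirr, hp.mem (hp.monic.natDegree_pos_of_not_isUnit
      hirr.not_isUnit), hpf⟩
  refine Set.Infinite.mono hsub fun hfin => ?_
  -- If there were finitely many such `p`, a single `c` would serve for all of them.
  obtain ⟨c, hc, hc0⟩ := (((eventually_all_finite hfin).2 fun p hp =>
    eventually_isDominated (v := val w) hp.1.monic fun i hi =>
      mem_maximalIdeal_iff.1 (hp.1.mem hi)).and self_mem_nhdsWithin).exists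
  replace hc0 : 0 < c := hc0
  obtain ⟨k, V, hk⟩ := exists_isFirstMin hc0 (fun i => (hpos i).le) hi₀top
  -- A smaller slope `c'` gives a divisor `Q` of degree above the bound `k` that `c` imposes.
  obtain ⟨s, c', hc', hs, hlarge⟩ := exists_le_of_isFirstMin hpos hinf (k + 1)
  obtain ⟨k', V', hk'⟩ := exists_isFirstMin hc' (fun i => (hpos i).le) hi₀top
  obtain ⟨Q, hQ, hQdeg, q, hq⟩ := exists_dvd_of_isFirstMin hcomp hc' hs hk'
  have hdom : IsDominated (val w) c Q := isDominated_of_irreducible_factors Q hQ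
    fun p hp hirr hpQ => hc p ⟨hp, hirr,
      ((Polynomial.coeToPowerSeries.ringHom (R := integerRing w)).map_dvd hpQ).trans ⟨q, hq⟩⟩
  obtain ⟨j, hj⟩ : ∃ j, val w (PowerSeries.coeff j q) ≠ ⊤ := by
    by_contra! h
    have hq0 : q = 0 := by
      ext j
      simpa using val_eq_top_iff.1 (h j)
    rw [hq, hq0, mul_zero, map_zero, AddValuation.map_zero] at hi₀top
    exact hi₀top rfl
  obtain ⟨l, W, hl⟩ := exists_isFirstMin hc0 (fun i => val_nonneg (PowerSeries.coeff i q)) hj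
  have h1 := hk.natDegree_le_of_eq_mul hdom hl hq
  have h2 := hlarge k' V' hk'
  omega
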